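/- Let $X$ be a proper geodesic metric space and let $e\in X$. A Morse gauge is a function $N=N(\lambda,\epsilon)\ge 0$ of $\lambda\ge 1$, $\epsilon\ge 0$. A geodesic $\alpha$ in $X$ has gauge $N$ if for all $\lambda\ge1$, $\epsilon\ge0$ every $(\lambda,\epsilon)$-quasi-geodesic with endpoints on $\alpha$ lies in the closed $N(\lambda,\epsilon)$-neighbourhood of $\alpha$; it is Morse if it has some gauge, and $N$-Morse if it and all of its subgeodesics have gauge $N$. Two Morse rays are equivalent if their Hausdorff distance is finite. For a Morse gauge $N$, let the stratum $\partial_M^N X$ be the set of equivalence classes that contain an $N$-Morse geodesic ray starting at $e$, with the quotient of the compact-open topology on the set of these rays. Let the Morse boundary be $\partial_M X=\varinjlim_N \partial_M^N X$, that is, the union of all strata, where a set is open if and only if its intersection with every stratum $\partial_M^N X$ is open in that stratum. Suppose that $\partial_M X$ is $\sigma$-compact. Then $\partial_M X$ is totally disconnected if and only if $\partial_M^N X$ is totally disconnected for every Morse gauge $N$. -/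

import Mathlib

open Set Metric Topology
open scoped NNReal ENNReal

namespace MorseBdry

/-- A metric space is geodesic if any two points are joined by a geodesic segment. -/
def IsGeodesicSpace (X : Type*) [MetricSpace X] : Prop :=
  ∀ x y : X, ∃ γ : ℝ → X, γ 0 = x ∧ γ (dist x y) = y ∧
    ∀ s ∈ Icc 0 (dist x y), ∀ t ∈ Icc 0 (dist x y), dist (γ s) (γ t) = |s - t|

/-- `σ` restricted to `[a, b]` is a `(K, ε)`-quasi-geodesic (not assumed continuous). -/
def IsQuasiGeodesicOn {X : Type*} [MetricSpace X] (K ε : ℝ≥0) (σ : ℝ → X) (a b : ℝ) : Prop :=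
  ∀ s ∈ Icc a b, ∀ t ∈ Icc a b,
    (K : ℝ)⁻¹ * |s - t| - ε ≤ dist (σ s) (σ t) ∧ dist (σ s) (σ t) ≤ K * |s - t| + ε

/-- A Morse gauge is a function of the quasi-geodesic constants `(K, ε)`, `K ≥ 1`, `ε ≥ 0`, with
values in `[0, ∞)`; its values for `K < 1` are never used. -/
abbrev MorseGauge : Type := ℝ≥0 → ℝ≥0 → ℝ≥0

/-- `N` is a Morse gauge for (the geodesic with image) `A`: each `(K, ε)`-quasi-geodesic with
endpoints on `A` lies in the closed `N(K, ε)`-neighbourhood of `A`. -/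
def HasMorseGauge {X : Type*} [MetricSpace X] (N : MorseGauge) (A : Set X) : Prop :=
  ∀ (K ε : ℝ≥0) (σ : ℝ → X) (a b : ℝ), 1 ≤ K → a ≤ b → IsQuasiGeodesicOn K ε σ a b →
    σ a ∈ A → σ b ∈ A → σ '' Icc a b ⊆ cthickening (N K ε : ℝ) A

/-- The ray `α` is `N`-Morse: `N` is a Morse gauge for `α` and for all its subgeodesics, that is
the restrictions of `α` to subintervals of `[0, ∞)`. -/
def IsNMorse {X : Type*} [MetricSpace X] (N : MorseGauge) (α : C(ℝ≥0, X)) : Prop :=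
  ∀ I : Set ℝ≥0, I.OrdConnected → HasMorseGauge N (α '' I)

/-- Morse geodesic rays in `X`, with any starting point. -/
def MorseRay (X : Type*) [MetricSpace X] : Type _ :=
  {α : C(ℝ≥0, X) // Isometry α ∧ ∃ N : MorseGauge, HasMorseGauge N (range α)}

/-- Two Morse rays are equivalent if the Hausdorff distance of their images is finite. -/
instance morseRaySetoid (X : Type*) [MetricSpace X] : Setoid (MorseRay X) where
  r α β := hausdorffEDist (range α.1) (range β.1) ≠ ⊤
  iseqv :=
    { refl := fun α => by simp
      symm := fun {α β} h => by rwa [hausdorffEDist_comm]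
      trans := fun {α β γ} h₁ h₂ =>
        ne_top_of_le_ne_top (ENNReal.add_ne_top.2 ⟨h₁, h₂⟩) hausdorffEDist_triangle }

/-- Equivalence classes of Morse rays. -/
def MorseClass (X : Type*) [MetricSpace X] : Type _ := Quotient (morseRaySetoid X)

/-- The `N`-Morse geodesic rays starting at `e`. As a subtype of `C(ℝ≥0, X)` this carries the
compact-open topology. -/
abbrev BasedRay {X : Type*} [MetricSpace X] (e : X) (N : MorseGauge) : Type _ :=
  {α : C(ℝ≥0, X) // Isometry α ∧ IsNMorse N α ∧ α 0 = e}

/-- An `N`-Morse ray is in particular a Morse ray. -/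
def BasedRay.toMorseRay {X : Type*} [MetricSpace X] {e : X} {N : MorseGauge}
    (α : BasedRay e N) : MorseRay X :=
  ⟨α.1, α.2.1, N, by simpa using α.2.2.1 univ ordConnected_univ⟩

/-- The class of an `N`-Morse ray. -/
def BasedRay.toClass {X : Type*} [MetricSpace X] {e : X} {N : MorseGauge}
    (α : BasedRay e N) : MorseClass X :=
  Quotient.mk (morseRaySetoid X) α.toMorseRay

/-- The stratum `∂_M^N X_e`: the classes containing an `N`-Morse ray that starts at `e`. -/
def Stratum {X : Type*} [MetricSpace X] (e : X) (N : MorseGauge) : Type _ :=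
  {x : MorseClass X // ∃ β : BasedRay e N, β.toClass = x}

/-- The projection from `N`-Morse rays starting at `e` to the stratum. -/
def Stratum.proj {X : Type*} [MetricSpace X] (e : X) (N : MorseGauge) (β : BasedRay e N) :
    Stratum e N :=
  ⟨β.toClass, β, rfl⟩

/-- The stratum carries the quotient of the compact-open topology on rays. -/
instance {X : Type*} [MetricSpace X] (e : X) (N : MorseGauge) : TopologicalSpace (Stratum e N) :=
  TopologicalSpace.coinduced (Stratum.proj e N) inferInstance

/-- The Morse boundary with basepoint `e`: as a set, the direct limit of the strata along the
inclusions is the union of all strata. -/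
def MorseBoundary {X : Type*} [MetricSpace X] (e : X) : Type _ :=
  {x : MorseClass X // ∃ (N : MorseGauge) (β : BasedRay e N), β.toClass = x}

/-- The inclusion of a stratum into the Morse boundary. -/
def Stratum.incl {X : Type*} [MetricSpace X] (e : X) (N : MorseGauge) (x : Stratum e N) :
    MorseBoundary e :=
  ⟨x.1, N, x.2⟩

/-- The direct limit topology: `U` is open iff its trace on each stratum is open. -/
instance {X : Type*} [MetricSpace X] (e : X) : TopologicalSpace (MorseBoundary e) where
  IsOpen U := ∀ N : MorseGauge, IsOpen (Stratum.incl e N ⁻¹' U)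
  isOpen_univ := fun _ => isOpen_univ
  isOpen_inter := fun _ _ hU hV N => (hU N).inter (hV N)
  isOpen_sUnion := fun S hS N => by
    rw [preimage_sUnion]
    exact isOpen_biUnion fun U hU => hS U hU N

end MorseBdry

/-!
Strata include continuously into the Morse boundary, so they are totally disconnected if it is.

For the converse, a σ-compact boundary is the union of countably many strata: a compact subset of
the boundary has a common Morse gauge, as it would otherwise contain an infinite closed discrete
subset (`exists_isNMorse_of_isCompact`). Each of these strata lies in the compact totally
disconnected set of boundary points of limits of `N`-Morse rays, which is contained in a slightly
larger stratum. A countable union of compact totally disconnected closed sets is totally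
disconnected if the ambient space is normal (`totallyDisconnectedSpace_of_iUnion_isCompact`). The
direct limit topology is not visibly normal, since countably many strata need not determine it. But
a coarser topology suffices, and as the boundary is σ-compact, this topology only has to be regular
and Hausdorff.

Such a topology is obtained from the points `p` of `X` that lie on a `(4 ^ k, k)`-quasi-geodesic
from `e` which eventually follows a ray `α` (`Reach k α p`). Rays `α` and `β` are `n`-close if, in
the ball of radius `n`, points reached along one of them with level `k ≤ n` are reached along the
other with level `k + 1`. The key is `exists_redirect`: a quasi-geodesic that comes within any
distance `D` of a geodesic ray `β` with the same origin, far enough out in terms of `D`, can be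
redirected to follow `β` eventually, with new constants that depend only on the old ones. The
junction is found by almost minimising the functional `s + 4 K * dist (σ s) (β t) - 2 K * t`, whose
near-minimality yields the quasi-geodesic inequality for the concatenation.
Hence, near a Morse ray, a loss of two levels in a large ball is a loss of only one level in a given
smaller ball (`exists_close_comp`), and this local composition property makes the
`n`-close relations the neighbourhoods of a regular Hausdorff topology
(`LocalEntourages.t3Space`). Rays with a common Morse gauge that agree for a long time are
`n`-close (`exists_radius_close`), so the new topology is coarser than the direct limit topology.
-/

namespace MorseBdry

/-! ### Totally disconnected unions in normal spaces -/

/-- A compact totally disconnected set can be distributed among two open sets with disjoint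
closures, after enlarging them. -/
lemma exists_open_pair_covering {Z : Type*} [TopologicalSpace Z] [T2Space Z] [NormalSpace Z]
    {F : Set Z} (hF : IsCompact F) (hFd : IsTotallyDisconnected F) {A B : Set Z}
    (hAB : Disjoint (closure A) (closure B)) :
    ∃ A' B' : Set Z, IsOpen A' ∧ IsOpen B' ∧ Disjoint (closure A') (closure B') ∧
      A ⊆ A' ∧ B ⊆ B' ∧ F ⊆ A' ∪ B' := by
  have : CompactSpace F := isCompact_iff_compactSpace.1 hF
  have : TotallyDisconnectedSpace F := totallyDisconnectedSpace_subtype_iff.2 hFd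
  obtain ⟨C, hC, hAC, hCB⟩ := exists_clopen_of_closed_subset_open
    (Z := ((↑) : F → Z) ⁻¹' closure A) (U := ((↑) : F → Z) ⁻¹' (closure B)ᶜ)
    (isClosed_closure.preimage continuous_subtype_val)
    (isClosed_closure.isOpen_compl.preimage continuous_subtype_val)
    (preimage_mono (disjoint_left.1 hAB))
  have hC₁ : IsClosed (((↑) : F → Z) '' C) := (hC.1.isCompact.image continuous_subtype_val).isClosed
  have hC₂ : IsClosed (((↑) : F → Z) '' Cᶜ) :=
    (hC.2.isClosed_compl.isCompact.image continuous_subtype_val).isClosed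
  have hdisj : closure A ∪ ((↑) : F → Z) '' C ⊆ (closure B ∪ ((↑) : F → Z) '' Cᶜ)ᶜ := by
    rintro z (hz | ⟨w, hw, rfl⟩) (hz' | ⟨w', hw', hww'⟩)
    · exact disjoint_left.1 hAB hz hz'
    · exact hw' (hAC (by simpa [hww'] using hz))
    · exact hCB hw hz'
    · exact hw' (Subtype.ext hww' ▸ hw)
  obtain ⟨A', hA', hAA', hclA'⟩ := normal_exists_closure_subset (isClosed_closure.union hC₁)
    (isClosed_closure.union hC₂).isOpen_compl hdisj
  obtain ⟨B', hB', hBB', hclB'⟩ := normal_exists_closure_subset (isClosed_closure.union hC₂)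
    (isClosed_closure (s := A')).isOpen_compl (subset_compl_comm.1 hclA')
  refine ⟨A', B', hA', hB', (disjoint_left.2 fun z hz => hclB' hz).symm,
    subset_closure.trans (subset_union_left.trans hAA'),
    subset_closure.trans (subset_union_left.trans hBB'), fun z hz => ?_⟩
  by_cases h : (⟨z, hz⟩ : F) ∈ C
  · exact Or.inl (hAA' (Or.inr ⟨_, h, rfl⟩))
  · exact Or.inr (hBB' (Or.inr ⟨_, h, rfl⟩))

/-- The countable closed sum theorem of dimension theory in dimension zero, for compact pieces. -/
lemma totallyDisconnectedSpace_of_iUnion_isCompact {Z : Type*} [TopologicalSpace Z] [T2Space Z]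
    [NormalSpace Z] (F : ℕ → Set Z) (hF : ∀ n, IsCompact (F n))
    (hFd : ∀ n, IsTotallyDisconnected (F n)) (hcov : ⋃ n, F n = univ) :
    TotallyDisconnectedSpace Z := by
  suffices TotallySeparatedSpace Z from inferInstance
  refine ⟨fun x _ y _ hxy => ?_⟩
  let P := {p : Set Z × Set Z // Disjoint (closure p.1) (closure p.2)}
  have step : ∀ (n : ℕ) (p : P), ∃ q : P, (IsOpen q.1.1 ∧ IsOpen q.1.2) ∧ p.1.1 ⊆ q.1.1 ∧
      p.1.2 ⊆ q.1.2 ∧ F n ⊆ q.1.1 ∪ q.1.2 := fun n p => by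
    obtain ⟨A', B', hA', hB', hd, hA, hB, hcov⟩ := exists_open_pair_covering (hF n) (hFd n) p.2
    exact ⟨⟨(A', B'), hd⟩, ⟨hA', hB'⟩, hA, hB, hcov⟩
  choose next hopen hl hr hc using step
  let s : ℕ → P := fun n => Nat.rec ⟨({x}, {y}), by simpa using hxy⟩ next n
  have hs : ∀ n, s (n + 1) = next n (s n) := fun n => rfl
  have hl' : Monotone fun n => (s n).1.1 := monotone_nat_of_le_succ fun n => hl n (s n)
  have hr' : Monotone fun n => (s n).1.2 := monotone_nat_of_le_succ fun n => hr n (s n)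
  refine ⟨⋃ n, (s (n + 1)).1.1, ⋃ n, (s (n + 1)).1.2, isOpen_iUnion fun n => (hopen n (s n)).1,
    isOpen_iUnion fun n => (hopen n (s n)).2, mem_iUnion.2 ⟨0, hl' (Nat.zero_le 1) rfl⟩,
    mem_iUnion.2 ⟨0, hr' (Nat.zero_le 1) rfl⟩, fun z _ => ?_, ?_⟩
  · obtain ⟨n, hn⟩ := mem_iUnion.1 (hcov ▸ mem_univ z)
    rcases hc n (s n) hn with h | h
    · exact Or.inl (mem_iUnion.2 ⟨n, h⟩)
    · exact Or.inr (mem_iUnion.2 ⟨n, h⟩)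
  · refine disjoint_left.2 fun z hz hz' => ?_
    obtain ⟨n, hn⟩ := mem_iUnion.1 hz
    obtain ⟨m, hm⟩ := mem_iUnion.1 hz'
    exact disjoint_left.1 (s (max (n + 1) (m + 1))).2
      (subset_closure (hl' (le_max_left _ _) hn)) (subset_closure (hr' (le_max_right _ _) hm))

/-! ### Topologies from a sequence of local entourages -/

/-- A decreasing sequence of reflexive symmetric relations whose composition is controlled locally:
near `x`, composing two fine relations gives a relation as fine as desired, but how fine the
relations have to be may depend on `x`. -/
structure LocalEntourages {Z : Type*} (E : ℕ → Z → Z → Prop) : Prop where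
  refl : ∀ n x, E n x x
  symm : ∀ n x y, E n x y → E n y x
  anti : ∀ m n x y, m ≤ n → E n x y → E m x y
  comp : ∀ x n, ∃ m, ∀ y z, E m x y → E m y z → E n x z
  sep : ∀ x y, (∀ n, E n x y) → x = y

namespace LocalEntourages

variable {Z : Type*} {E : ℕ → Z → Z → Prop}

/-- The neighbourhood filter at `x` of the topology of a sequence of local entourages. -/
def nhdsFilter (E : ℕ → Z → Z → Prop) (x : Z) : Filter Z := ⨅ n, Filter.principal {y | E n x y}

lemma hasBasis (h : LocalEntourages E) (x : Z) :
    (nhdsFilter E x).HasBasis (fun _ => True) fun n => {y | E n x y} :=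
  Filter.hasBasis_iInf_principal
    (directed_of_isDirected_le fun _ _ hmn _ hy => h.anti _ _ _ _ hmn hy)

lemma nhds_hasBasis (h : LocalEntourages E) (x : Z) :
    (@nhds Z (.mkOfNhds (nhdsFilter E)) x).HasBasis (fun _ => True) fun n => {y | E n x y} := by
  rw [TopologicalSpace.nhds_mkOfNhds_of_hasBasis h.hasBasis (fun a n _ => h.refl n a)]
  · exact h.hasBasis x
  · intro a n _
    obtain ⟨m, hm⟩ := h.comp a n
    filter_upwards [(h.hasBasis a).mem_of_mem (i := m) trivial] with y hy
    exact (h.hasBasis y).mem_iff.2 ⟨m, trivial, fun z hz => hm y z hy hz⟩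

lemma t3Space (h : LocalEntourages E) : @T3Space Z (.mkOfNhds (nhdsFilter E)) := by
  let _ : TopologicalSpace Z := .mkOfNhds (nhdsFilter E)
  have hreg : RegularSpace Z := by
    refine .of_exists_mem_nhds_isClosed_subset fun x s hs => ?_
    obtain ⟨n, -, hn⟩ := (h.nhds_hasBasis x).mem_iff.1 hs
    obtain ⟨m, hm⟩ := h.comp x n
    refine ⟨closure {y | E m x y}, Filter.mem_of_superset
      ((h.nhds_hasBasis x).mem_of_mem trivial) subset_closure, isClosed_closure, fun y hy => hn ?_⟩
    obtain ⟨z, hz, hz'⟩ := (mem_closure_iff_nhds_basis (h.nhds_hasBasis y)).1 hy m trivial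
    exact hm z y hz (h.symm _ _ _ hz')
  have hT1 : T1Space Z := by
    refine t1Space_iff_exists_open.2 fun x y hxy => ?_
    obtain ⟨n, hn⟩ := not_forall.1 (mt (h.sep x y) hxy)
    obtain ⟨U, hU, hUo, hxU⟩ := mem_nhds_iff.1 ((h.nhds_hasBasis x).mem_of_mem (i := n) trivial)
    exact ⟨U, hUo, hxU, fun hy => hn (hU hy)⟩
  exact { }

end LocalEntourages

variable {X : Type*} [MetricSpace X]

/-! ### Continuing a quasi-geodesic along a geodesic ray -/

lemma isQuasiGeodesicOn_of_le {K ε : ℝ≥0} {σ : ℝ → X} {a b : ℝ} (hK : 1 ≤ K)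
    (h : ∀ s t, a ≤ s → s ≤ t → t ≤ b → t - s ≤ K * (dist (σ s) (σ t) + ε) ∧
      dist (σ s) (σ t) ≤ K * (t - s) + ε) : IsQuasiGeodesicOn K ε σ a b := by
  have hK' : (0 : ℝ) < K := by exact_mod_cast zero_lt_one.trans_le hK
  have key : ∀ s t, a ≤ s → s ≤ t → t ≤ b → (K : ℝ)⁻¹ * (t - s) - ε ≤ dist (σ s) (σ t) ∧
      dist (σ s) (σ t) ≤ K * (t - s) + ε := fun s t h₁ h₂ h₃ => by
    refine ⟨?_, (h s t h₁ h₂ h₃).2⟩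
    rw [sub_le_iff_le_add, inv_mul_le_iff₀ hK']
    exact (h s t h₁ h₂ h₃).1
  intro s hs t ht
  rcases le_total s t with hst | hst
  · rw [abs_sub_comm, abs_of_nonneg (sub_nonneg.2 hst)]
    exact key s t hs.1 hst ht.2
  · rw [abs_of_nonneg (sub_nonneg.2 hst), dist_comm]
    exact key t s ht.1 hst hs.2

lemma IsQuasiGeodesicOn.sub_le {K ε : ℝ≥0} {σ : ℝ → X} {a b : ℝ} (hK : 1 ≤ K)
    (h : IsQuasiGeodesicOn K ε σ a b) {s t : ℝ} (hs : a ≤ s) (hst : s ≤ t) (ht : t ≤ b) :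
    t - s ≤ K * (dist (σ s) (σ t) + ε) := by
  have hK' : (0 : ℝ) < K := by exact_mod_cast zero_lt_one.trans_le hK
  have := (h s ⟨hs, hst.trans ht⟩ t ⟨hs.trans hst, ht⟩).1
  rwa [abs_sub_comm, abs_of_nonneg (sub_nonneg.2 hst), sub_le_iff_le_add,
    inv_mul_le_iff₀ hK'] at this

lemma IsQuasiGeodesicOn.dist_le {K ε : ℝ≥0} {σ : ℝ → X} {a b : ℝ}
    (h : IsQuasiGeodesicOn K ε σ a b) {s t : ℝ} (hs : a ≤ s) (hst : s ≤ t) (ht : t ≤ b) :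
    dist (σ s) (σ t) ≤ K * (t - s) + ε := by
  have := (h s ⟨hs, hst.trans ht⟩ t ⟨hs.trans hst, ht⟩).2
  rwa [abs_sub_comm, abs_of_nonneg (sub_nonneg.2 hst)] at this

lemma IsQuasiGeodesicOn.mono {K ε K' ε' : ℝ≥0} {σ : ℝ → X} {a b b' : ℝ} (hK : 1 ≤ K)
    (hKK' : K ≤ K') (hε : ε ≤ ε') (hb : b' ≤ b) (h : IsQuasiGeodesicOn K ε σ a b) :
    IsQuasiGeodesicOn K' ε' σ a b' := by
  have h₁ : (K : ℝ) ≤ K' := hKK'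
  have h₂ : (ε : ℝ) ≤ ε' := hε
  refine isQuasiGeodesicOn_of_le (hK.trans hKK') fun s t hs hst ht => ⟨?_, ?_⟩
  · refine (h.sub_le hK hs hst (ht.trans hb)).trans ?_
    gcongr
  · refine (h.dist_le hs hst (ht.trans hb)).trans ?_
    have := sub_nonneg.2 hst
    gcongr

/-- A junction of `σ` with `β` that almost minimises
`Φ (s, t) = s + 4 K * dist (σ s) (β t) - 2 K * t`. -/
lemma exists_junction {K A : ℝ≥0} (hK : 1 ≤ K) {σ β : ℝ → X} {s₁ t₁ : ℝ} (hs₁ : 0 ≤ s₁)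
    (ht₁ : 0 ≤ t₁) (hσ : IsQuasiGeodesicOn K A σ 0 s₁)
    (hβ : ∀ s t, 0 ≤ s → s ≤ t → dist (β s) (β t) = t - s) (h0 : σ 0 = β 0) :
    ∃ s' ∈ Icc 0 s₁, ∃ t', 0 ≤ t' ∧ ∀ s ∈ Icc 0 s₁, ∀ t, 0 ≤ t →
      s' + 4 * K * dist (σ s') (β t') - 2 * K * t' ≤
        s + 4 * K * dist (σ s) (β t) - 2 * K * t + 1 := by
  have hK' : (1 : ℝ) ≤ K := hK
  let S : Set ℝ := {x | ∃ s ∈ Icc 0 s₁, ∃ t, 0 ≤ t ∧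
    x = s + 4 * K * dist (σ s) (β t) - 2 * K * t}
  have hne : S.Nonempty := ⟨_, s₁, right_mem_Icc.2 hs₁, t₁, ht₁, rfl⟩
  have hbdd : BddBelow S := by
    refine ⟨-(4 * K * (K * s₁ + A)), ?_⟩
    rintro _ ⟨s, hs, t, ht, rfl⟩
    have h₁ := hσ.dist_le le_rfl hs.1 hs.2
    have h₂ := hβ 0 t le_rfl ht
    have h₃ := dist_triangle_left (β 0) (β t) (σ s)
    rw [← h0, dist_comm (σ s) (σ 0)] at h₃
    rw [← h0] at h₂
    have h₄ : t ≤ K * s₁ + A + dist (σ s) (β t) := by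
      have : (K : ℝ) * (s - 0) ≤ K * s₁ := by gcongr; linarith [hs.2]
      linarith
    have h₅ : 4 * K * t ≤ 4 * K * (K * s₁ + A + dist (σ s) (β t)) := by gcongr
    nlinarith [hs.1, mul_nonneg (zero_le_one.trans hK') ht]
  obtain ⟨x, ⟨s', hs', t', ht', rfl⟩, hx⟩ := exists_lt_of_csInf_lt hne (lt_add_one (sInf S))
  exact ⟨s', hs', t', ht', fun s hs t ht =>
    hx.le.trans (add_le_add_left (csInf_le hbdd ⟨s, hs, t, ht, rfl⟩) 1)⟩

/-- If a quasi-geodesic starting at the origin of a geodesic ray `β` comes within distance `D` of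
`β` far out, then it can be redirected to follow `β` eventually. The new constants do not depend on
`D`, and the new quasi-geodesic still runs through a given point `σ s₀`, provided that the closeness
occurs far enough out in terms of `D` and of the distance `r` of this point from the origin. -/
lemma exists_redirect (hX : IsGeodesicSpace X) {K A : ℝ≥0} (hK : 1 ≤ K) {D r : ℝ} {σ β : ℝ → X}
    {s₀ s₁ t₁ : ℝ} (hs₀ : 0 ≤ s₀) (hs₀₁ : s₀ ≤ s₁) (hσ : IsQuasiGeodesicOn K A σ 0 s₁)
    (hβ : ∀ s t, 0 ≤ s → s ≤ t → dist (β s) (β t) = t - s) (h0 : σ 0 = β 0)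
    (hr : dist (σ 0) (σ s₀) ≤ r) (hD : dist (σ s₁) (β t₁) ≤ D)
    (ht₁ : 5 * D + 3 * A + 1 + 2 * K * (K * (r + A)) ≤ t₁) :
    ∃ τ : ℝ → X, (∀ b, IsQuasiGeodesicOn (4 * K) (A + 1) τ 0 b) ∧ τ 0 = σ 0 ∧
      (∃ s, 0 ≤ s ∧ τ s = σ s₀) ∧ ∃ b t, 0 ≤ b ∧ 0 ≤ t ∧ ∀ u, 0 ≤ u → τ (b + u) = β (t + u) := by
  have hK' : (1 : ℝ) ≤ K := hK
  have hK0 : (0 : ℝ) ≤ K := zero_le_one.trans hK'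
  have hA : (0 : ℝ) ≤ A := A.2
  have hr0 : 0 ≤ r := dist_nonneg.trans hr
  have hD0 : 0 ≤ D := dist_nonneg.trans hD
  have ht₁0 : 0 ≤ t₁ := by
    refine le_trans ?_ ht₁
    positivity
  have hs₁ : 0 ≤ s₁ := hs₀.trans hs₀₁
  obtain ⟨s', hs', t', ht', hmin⟩ := exists_junction hK hs₁ ht₁0 hσ hβ h0
  set d := dist (σ s') (β t') with hd
  have hd0 : 0 ≤ d := dist_nonneg
  -- The junction lies beyond `s₀`: comparing its value of `Φ` with the one at `(s₁, t₁)` shows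
  -- that `t'` is about `t₁ / 2` or more, and that `d` is at most about `t' / 2`, so that `σ s'` is
  -- further from the origin than `σ s₀`.
  have hs₀' : s₀ ≤ s' := by
    have e₁ := hmin s₁ (right_mem_Icc.2 hs₁) t₁ ht₁0
    have e₂ := hσ.sub_le hK le_rfl hs₁ le_rfl
    have e₃ : dist (σ 0) (σ s₁) ≤ t₁ + D := by
      have := dist_triangle_right (σ 0) (σ s₁) (β t₁)
      rw [h0, hβ 0 t₁ le_rfl ht₁0] at this
      rw [h0]; linarith
    have e₄ : t' ≤ K * s' + A + d := by
      have a₁ := hσ.dist_le le_rfl hs'.1 hs'.2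
      have a₂ := dist_triangle (σ 0) (σ s') (β t')
      rw [h0, hβ 0 t' le_rfl ht', ← h0] at a₂
      linarith
    have e₅ := hσ.sub_le hK le_rfl hs₀ hs₀₁
    have e₆ : s₀ ≤ K * (r + A) := by
      refine le_trans (by linarith) (e₅.trans ?_); gcongr
    have e₇ : s₁ ≤ K * (t₁ + D + A) := by
      refine le_trans (by linarith) (e₂.trans ?_); gcongr
    have e₈ : 4 * K * dist (σ s₁) (β t₁) ≤ 4 * K * D := by gcongr
    have e₉ : K * (t₁ + 4 * d - 2 * t' - 5 * D - A - 1) ≤ 0 := by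
      have := hs'.1
      nlinarith
    have e₁₀ : t₁ + 4 * d - 2 * t' - 5 * D - A - 1 ≤ 0 := by
      by_contra hcon
      push Not at hcon
      nlinarith
    have e₁₁ : (K : ℝ) * (K * (r + A)) ≤ K * s' := by linarith
    exact e₆.trans (le_of_mul_le_mul_left e₁₁ (by linarith))
  obtain ⟨γ, hγ0, hγ1, hγ⟩ := hX (σ s') (β t')
  rw [← hd] at hγ1 hγ
  have hγ' : ∀ v w, 0 ≤ v → v ≤ w → w ≤ d → dist (γ v) (γ w) = w - v := fun v w h₁ h₂ h₃ => by
    rw [hγ v ⟨h₁, h₂.trans h₃⟩ w ⟨h₁.trans h₂, h₃⟩, abs_sub_comm, abs_of_nonneg (sub_nonneg.2 h₂)]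
  -- the consequences of near-minimality for the different pairs of pieces
  have hσβ : ∀ s, 0 ≤ s → s ≤ s' → ∀ t, t' ≤ t →
      (s' - s) + 4 * K * d + 2 * K * (t - t') ≤
        4 * K * dist (σ s) (β t) + 1 := fun s h₁ h₂ t h₃ => by
    have := hmin s ⟨h₁, h₂.trans hs'.2⟩ t (ht'.trans h₃)
    linarith
  have hσγ : ∀ s, 0 ≤ s → s ≤ s' → ∀ w, 0 ≤ w → w ≤ d →
      (s' - s) + 4 * K * w ≤ 4 * K * dist (σ s) (γ w) + 1 := fun s h₁ h₂ w h₃ h₄ => by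
    have e₁ := hσβ s h₁ h₂ t' le_rfl
    have e₂ := dist_triangle (σ s) (γ w) (β t')
    rw [← hγ1, hγ' w d h₃ h₄ le_rfl, hγ1] at e₂
    have e₃ : 4 * K * dist (σ s) (β t') ≤ 4 * K * (dist (σ s) (γ w) + (d - w)) := by gcongr
    linarith
  have hγβ : ∀ w, 0 ≤ w → w ≤ d → ∀ t, t' ≤ t →
      4 * K * (d - w) + 2 * K * (t - t') ≤ 4 * K * dist (γ w) (β t) + 1 := fun w h₃ h₄ t h₅ => by
    have e₁ := hσβ s' hs'.1 le_rfl t h₅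
    have e₂ := dist_triangle (σ s') (γ w) (β t)
    rw [← hγ0, hγ' 0 w le_rfl h₃ h₄, hγ0] at e₂
    have e₃ : 4 * K * dist (σ s') (β t) ≤ 4 * K * ((w - 0) + dist (γ w) (β t)) := by gcongr
    linarith
  let τ : ℝ → X := fun u => if u ≤ s' then σ u else if u ≤ s' + d then γ (u - s') else
    β (t' + (u - (s' + d)))
  have hτ₁ : ∀ u, u ≤ s' → τ u = σ u := fun u hu => if_pos hu
  have hτ₂ : ∀ u, s' ≤ u → u ≤ s' + d → τ u = γ (u - s') := fun u h₁ h₂ => by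
    rcases h₁.eq_or_lt with rfl | h₁
    · rw [hτ₁ s' le_rfl, sub_self, hγ0]
    · simp only [τ, if_neg h₁.not_ge, if_pos h₂]
  have hτ₃ : ∀ u, s' + d ≤ u → τ u = β (t' + (u - (s' + d))) := fun u h₁ => by
    rcases h₁.eq_or_lt with rfl | h₁
    · rw [hτ₂ (s' + d) (by linarith) le_rfl, add_sub_cancel_left, hγ1, sub_self, add_zero]
    · have : ¬ u ≤ s' := by linarith
      simp only [τ, if_neg h₁.not_ge, if_neg this]
  refine ⟨τ, fun b => ?_, hτ₁ 0 hs'.1, ⟨s₀, hs₀, hτ₁ s₀ hs₀'⟩, s' + d, t',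
    add_nonneg hs'.1 hd0, ht',
    fun u hu => by rw [hτ₃ _ (by linarith)]; congr 2; ring⟩
  refine isQuasiGeodesicOn_of_le (hK.trans (le_mul_of_one_le_left zero_le (by norm_num)))
    fun u v hu huv _ => ?_
  push_cast
  -- it suffices to bound the length by `4 K * dist + 1`, and the distance by `K * length + A`
  suffices h : v - u ≤ 4 * K * (dist (τ u) (τ v) + A) + 1 ∧ dist (τ u) (τ v) ≤ K * (v - u) + A by
    have := mul_le_mul_of_nonneg_right hK' (sub_nonneg.2 huv)
    constructor <;> nlinarith [h.1, h.2]
  have hKA : 0 ≤ 4 * K * (A : ℝ) := by positivity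
  rcases le_total v s' with hv | hv
  · rw [hτ₁ u (huv.trans hv), hτ₁ v hv]
    have e₁ := hσ.sub_le hK hu huv (hv.trans hs'.2)
    refine ⟨?_, hσ.dist_le hu huv (hv.trans hs'.2)⟩
    have : 0 ≤ K * (dist (σ u) (σ v) + A) := by positivity
    linarith
  rcases le_total v (s' + d) with hv' | hv'
  · rw [hτ₂ v hv hv']
    have hw : 0 ≤ v - s' := by linarith
    have hw' := mul_le_mul_of_nonneg_right hK' hw
    rcases le_total u s' with h | h
    · rw [hτ₁ u h]
      constructor
      · have := hσγ u hu h (v - s') hw (by linarith)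
        linarith
      · have e₁ := dist_triangle (σ u) (σ s') (γ (v - s'))
        rw [← hγ0, hγ' 0 _ le_rfl hw (by linarith), hγ0] at e₁
        have e₂ := hσ.dist_le hu h hs'.2
        linarith
    · rw [hτ₂ u h (huv.trans hv'), hγ' _ _ (by linarith) (by linarith) (by linarith)]
      constructor <;> nlinarith
  · have hw : 0 ≤ v - (s' + d) := by linarith
    have hw' := mul_le_mul_of_nonneg_right hK' hw
    have hwd := mul_le_mul_of_nonneg_right hK' hd0
    rw [hτ₃ v hv']
    rcases le_total u s' with h | h
    · rw [hτ₁ u h]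
      constructor
      · have := hσβ u hu h (t' + (v - (s' + d))) (by linarith)
        linarith
      · have e₁ := dist_triangle4 (σ u) (σ s') (β t') (β (t' + (v - (s' + d))))
        rw [hβ t' _ ht' (by linarith), ← hd] at e₁
        have e₂ := hσ.dist_le hu h hs'.2
        linarith
    rcases le_total u (s' + d) with h' | h'
    · rw [hτ₂ u h h']
      have hu' := mul_le_mul_of_nonneg_right hK' (show 0 ≤ d - (u - s') by linarith)
      constructor
      · have := hγβ (u - s') (by linarith) (by linarith) (t' + (v - (s' + d))) (by linarith)
        linarith
      · have e₁ := dist_triangle (γ (u - s')) (γ d) (β (t' + (v - (s' + d))))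
        rw [hγ' _ d (by linarith) (by linarith) le_rfl, hγ1, hβ t' _ ht' (by linarith)] at e₁
        linarith
    · rw [hτ₃ u h', hβ _ _ (by linarith) (by linarith)]
      constructor <;> nlinarith

/-! ### Points on quasi-geodesics that end along a ray -/

/-- `Reach k α p`: some `(4 ^ k, k)`-quasi-geodesic from `α 0` runs through `p` and eventually
follows the ray `α`. -/
def Reach (k : ℕ) (α : C(ℝ≥0, X)) (p : X) : Prop :=
  ∃ σ : ℝ → X, (∀ b, IsQuasiGeodesicOn (4 ^ k) k σ 0 b) ∧ σ 0 = α 0 ∧ (∃ s, 0 ≤ s ∧ σ s = p) ∧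
    ∃ b t, 0 ≤ b ∧ 0 ≤ t ∧ ∀ u, 0 ≤ u → σ (b + u) = α (t + u).toNNReal

lemma one_le_four_pow (k : ℕ) : (1 : ℝ≥0) ≤ 4 ^ k := one_le_pow₀ (by norm_num)

lemma dist_toNNReal {α : C(ℝ≥0, X)} (hα : Isometry α) {s t : ℝ} (hs : 0 ≤ s) (hst : s ≤ t) :
    dist (α s.toNNReal) (α t.toNNReal) = t - s := by
  rw [hα.dist_eq, NNReal.dist_eq, Real.coe_toNNReal _ hs, Real.coe_toNNReal _ (hs.trans hst),
    abs_sub_comm, abs_of_nonneg (sub_nonneg.2 hst)]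

lemma dist_zero_apply {α : C(ℝ≥0, X)} (hα : Isometry α) (t : ℝ≥0) : dist (α 0) (α t) = t := by
  rw [hα.dist_eq, NNReal.dist_eq, NNReal.coe_zero, zero_sub, abs_neg, NNReal.abs_eq]

lemma Reach.succ {k : ℕ} {α : C(ℝ≥0, X)} {p : X} (h : Reach k α p) : Reach (k + 1) α p := by
  obtain ⟨σ, hσ, h0, hs, hb⟩ := h
  exact ⟨σ, fun b => (hσ b).mono (one_le_four_pow k)
    (pow_le_pow_right₀ (by norm_num) (Nat.le_succ k)) (by exact_mod_cast Nat.le_succ k) le_rfl,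
    h0, hs, hb⟩

lemma reach_zero {α : C(ℝ≥0, X)} (hα : Isometry α) (t : ℝ≥0) : Reach 0 α (α t) := by
  refine ⟨fun s => α s.toNNReal, fun b => isQuasiGeodesicOn_of_le (one_le_four_pow 0)
    fun s t hs hst _ => ?_, by simp, ⟨t, t.2, by simp⟩, 0, 0, le_rfl, le_rfl, fun u _ => by simp⟩
  rw [dist_toNNReal hα hs hst]
  simp

lemma reach_succ_of_redirect (hX : IsGeodesicSpace X) {k : ℕ} {D r : ℝ} {σ : ℝ → X}
    {β : C(ℝ≥0, X)} (hβ : Isometry β) (hσ : ∀ b, IsQuasiGeodesicOn (4 ^ k) k σ 0 b)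
    (h0 : σ 0 = β 0) {s₀ s₁ : ℝ} {t₁ : ℝ≥0} (hs₀ : 0 ≤ s₀) (hs₀₁ : s₀ ≤ s₁)
    (hr : dist (σ 0) (σ s₀) ≤ r) (hD : dist (σ s₁) (β t₁) ≤ D)
    (ht₁ : 5 * D + 3 * k + 1 + 2 * 4 ^ k * (4 ^ k * (r + k)) ≤ t₁) : Reach (k + 1) β (σ s₀) := by
  obtain ⟨τ, h₁, h₂, h₃, b, t, h₄⟩ := exists_redirect hX (one_le_four_pow k) (D := D) (r := r)
    (β := fun s => β s.toNNReal) (t₁ := t₁) hs₀ hs₀₁ (hσ s₁) (fun s t => dist_toNNReal hβ)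
    (by simpa using h0) hr (by simpa using hD) (by simpa using ht₁)
  exact ⟨τ, fun b => by simpa [pow_succ'] using h₁ b, h₂.trans h0, h₃, b, t, h₄⟩

/-- Points reached along `α` are reached, with worse constants, along any ray with the same origin
that stays close to `α`. -/
lemma Reach.of_close (hX : IsGeodesicSpace X) {k : ℕ} {α β : C(ℝ≥0, X)} {p : X} {D : ℝ}
    (h : Reach k α p) (hα : Isometry α) (hβ : Isometry β) (h0 : α 0 = β 0)
    (hD : ∀ t, ∃ t', dist (α t) (β t') ≤ D) : Reach (k + 1) β p := by
  obtain ⟨σ, hσ, hσ0, ⟨s₀, hs₀, rfl⟩, b, t, hb, ht, htail⟩ := h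
  set T := 5 * D + 3 * k + 1 + 2 * 4 ^ k * (4 ^ k * (dist (σ 0) (σ s₀) + k))
  set u := |T| + |D| + s₀
  have hu0 : 0 ≤ u := by positivity
  obtain ⟨t', ht'⟩ := hD (t + u).toNNReal
  refine reach_succ_of_redirect hX hβ hσ (hσ0.trans h0) (D := D) (s₁ := b + u) (t₁ := t') hs₀ ?_
    le_rfl
    (by rwa [htail u hu0]) ?_
  · linarith [abs_nonneg T, abs_nonneg D]
  · have e₁ := dist_triangle_right (α 0) (α (t + u).toNNReal) (β t')
    rw [dist_zero_apply hα, h0, dist_zero_apply hβ, Real.coe_toNNReal _ (add_nonneg ht hu0)] at e₁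
    linarith [le_abs_self T, le_abs_self D]

lemma exists_dist_lt_of_hasMorseGauge {N : MorseGauge} {α : C(ℝ≥0, X)}
    (hN : HasMorseGauge N (range α)) {k : ℕ} {p : X} (h : Reach k α p) :
    ∃ t, dist p (α t) < N (4 ^ k) k + 1 := by
  obtain ⟨σ, hσ, hσ0, ⟨s₀, hs₀, rfl⟩, b, t, hb, ht, htail⟩ := h
  have hmem := hN (4 ^ k) k σ 0 (b + s₀) (one_le_four_pow k) (by linarith) (hσ _)
    (hσ0 ▸ mem_range_self 0) (htail s₀ hs₀ ▸ mem_range_self _)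
    (mem_image_of_mem σ ⟨hs₀, by linarith⟩)
  obtain ⟨_, ⟨t, rfl⟩, h⟩ := mem_thickening_iff.1 (cthickening_subset_thickening'
    (δ₂ := N (4 ^ k) k + 1) (by positivity) (lt_add_one _) _ hmem)
  exact ⟨t, h⟩

/-- A point reached along a Morse ray at distance about `R` from the origin is close to the point
of the ray at distance `R`. -/
lemma dist_le_of_hasMorseGauge {N : MorseGauge} {α : C(ℝ≥0, X)} (hα : Isometry α)
    (hN : HasMorseGauge N (range α)) {k : ℕ} {p : X} (h : Reach k α p) {R : ℝ≥0} {L : ℝ}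
    (hL : R - L ≤ dist (α 0) p) (hR : dist (α 0) p ≤ R) :
    dist p (α R) ≤ 2 * (N (4 ^ k) k + 1) + L := by
  obtain ⟨t, ht⟩ := exists_dist_lt_of_hasMorseGauge hN h
  have e₁ := dist_triangle p (α t) (α R)
  rw [hα.dist_eq t R, NNReal.dist_eq] at e₁
  have e₂ := dist_triangle (α 0) p (α t)
  have e₃ := dist_triangle_right (α 0) p (α t)
  rw [dist_zero_apply hα] at e₂ e₃
  have e₄ : |(t : ℝ) - R| ≤ N (4 ^ k) k + 1 + L := abs_le.2 ⟨by linarith, by linarith⟩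
  linarith

/-- A uniform bound for the distance between a ray with Morse gauge `N` and an asymptotic ray with
the same origin. -/
def fellowBound (N : MorseGauge) : ℝ≥0 := 2 * (N (4 ^ 1) (1 : ℕ) + 1)

lemma dist_le_fellowBound (hX : IsGeodesicSpace X) {N : MorseGauge} {α β : C(ℝ≥0, X)}
    (hα : Isometry α) (hβ : Isometry β) (h0 : α 0 = β 0) (hN : HasMorseGauge N (range β))
    {D : ℝ} (hD : ∀ t, ∃ t', dist (α t) (β t') ≤ D) (t : ℝ≥0) :
    dist (α t) (β t) ≤ fellowBound N := by
  have h := dist_le_of_hasMorseGauge (R := t) (L := 0) hβ hN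
    ((reach_zero hα t).of_close hX hα hβ h0 hD)
    (by rw [← h0, dist_zero_apply hα, sub_zero]) (by rw [← h0, dist_zero_apply hα])
  simpa [fellowBound] using h

/-- A quasi-geodesic leaving every ball has points at roughly every distance from its origin,
although it need not be continuous. -/
lemma exists_dist_near {K A : ℝ≥0} (hK : 1 ≤ K) {σ : ℝ → X}
    (hσ : ∀ b, IsQuasiGeodesicOn K A σ 0 b) {R : ℝ} (hR : 0 ≤ R) :
    ∃ s, 0 ≤ s ∧ R - (K + A) ≤ dist (σ 0) (σ s) ∧ dist (σ 0) (σ s) ≤ R := by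
  let S := {s : ℝ | 0 ≤ s ∧ dist (σ 0) (σ s) ≤ R}
  have hne : S.Nonempty := ⟨0, le_rfl, by simpa using hR⟩
  have hbdd : BddAbove S := by
    refine ⟨K * (R + A), fun s hs => ?_⟩
    have e₁ := (hσ s).sub_le hK le_rfl hs.1 le_rfl
    rw [sub_zero] at e₁
    refine e₁.trans ?_
    have := hs.2
    gcongr
  obtain ⟨s, hs, hlt⟩ := exists_lt_of_lt_csSup hne (sub_one_lt (sSup S))
  refine ⟨s, hs.1, ?_, hs.2⟩
  have hs' : R < dist (σ 0) (σ (s + 1)) := by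
    by_contra hcon
    have := le_csSup hbdd (show s + 1 ∈ S from ⟨by linarith [hs.1], not_lt.1 hcon⟩)
    linarith
  have e₁ := dist_triangle (σ 0) (σ s) (σ (s + 1))
  have e₂ := (hσ (s + 1)).dist_le hs.1 (by linarith) le_rfl
  rw [add_sub_cancel_left, mul_one] at e₂
  linarith

/-- If the points at distance about `R` that are reached along `α` are close to `β R`, then the
points well inside the ball of radius `R` that are reached along `α` are reached along `β`. -/
lemma exists_radius_transfer (hX : IsGeodesicSpace X) (k : ℕ) (r D : ℝ) :
    ∃ R₀ : ℝ≥0, ∀ R ≥ R₀, ∀ α β : C(ℝ≥0, X), Isometry β → α 0 = β 0 →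
      (∀ q, Reach k α q → R - (4 ^ k + k) ≤ dist (α 0) q → dist (α 0) q ≤ R → dist q (β R) ≤ D) →
      ∀ p, dist (α 0) p ≤ r → Reach k α p → Reach (k + 1) β p := by
  refine ⟨(|5 * D + 3 * k + 1 + 2 * 4 ^ k * (4 ^ k * (r + k))| +
    |4 ^ k * (4 ^ k * (r + k)) + k + (4 ^ k + k)|).toNNReal, fun R hR α β hβ h0 hq p hp h => ?_⟩
  have hR' := Real.toNNReal_le_iff_le_coe.1 hR
  obtain ⟨σ, hσ, hσ0, ⟨s₀, hs₀, rfl⟩, htail⟩ := h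
  obtain ⟨s₁, hs₁, h₁, h₂⟩ := exists_dist_near (one_le_four_pow k) hσ R.coe_nonneg
  push_cast at h₁
  have hp' : dist (σ 0) (σ s₀) ≤ r := by rwa [hσ0]
  refine reach_succ_of_redirect hX hβ hσ (hσ0.trans h0) hs₀ ?_ hp'
    (hq (σ s₁) ⟨σ, hσ, hσ0, ⟨s₁, hs₁, rfl⟩, htail⟩ (by rwa [← hσ0]) (by rwa [← hσ0])) ?_
  · have e₁ := (hσ s₀).sub_le (one_le_four_pow k) le_rfl hs₀ le_rfl
    have e₂ := (hσ s₁).dist_le le_rfl hs₁ le_rfl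
    push_cast at e₁ e₂
    rw [sub_zero] at e₁ e₂
    have e₃ : (4 : ℝ) ^ k * (dist (σ 0) (σ s₀) + k) ≤ 4 ^ k * (r + k) := by gcongr
    have e₄ : (4 : ℝ) ^ k * (4 ^ k * (r + k)) ≤ 4 ^ k * s₁ := by
      have a₁ := le_abs_self ((4 : ℝ) ^ k * (4 ^ k * (r + k)) + k + (4 ^ k + k))
      have a₂ := abs_nonneg (5 * D + 3 * k + 1 + 2 * 4 ^ k * (4 ^ k * (r + k)))
      linarith
    exact e₁.trans (e₃.trans (le_of_mul_le_mul_left e₄ (by positivity)))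
  · have a₁ := abs_nonneg ((4 : ℝ) ^ k * (4 ^ k * (r + k)) + k + (4 ^ k + k))
    have a₂ := le_abs_self (5 * D + 3 * k + 1 + 2 * 4 ^ k * (4 ^ k * (r + k)))
    linarith

/-! ### Local entourages on rays -/

/-- Two rays are close at level `n` if, within distance `n` of the origin, they reach the same
points up to an increase of the constants by one level, for all levels up to `n`. -/
def Close (n : ℕ) (α β : C(ℝ≥0, X)) : Prop :=
  ∀ p, dist (α 0) p ≤ n → ∀ k ≤ n,
    (Reach k α p → Reach (k + 1) β p) ∧ (Reach k β p → Reach (k + 1) α p)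

lemma Close.symm {n : ℕ} {α β : C(ℝ≥0, X)} (h0 : α 0 = β 0) (h : Close n α β) : Close n β α :=
  fun p hp k hk => (h p (h0 ▸ hp) k hk).symm

lemma Close.anti {m n : ℕ} (hmn : m ≤ n) {α β : C(ℝ≥0, X)} (h : Close n α β) : Close m α β :=
  fun p hp k hk => h p (hp.trans (by exact_mod_cast hmn)) k (hk.trans hmn)

lemma exists_forall_le_of_forall {P : ℕ → ℝ≥0 → Prop} (h : ∀ k, ∃ R₀, ∀ R ≥ R₀, P k R) (n : ℕ) :
    ∃ R₀, ∀ R ≥ R₀, ∀ k ≤ n, P k R := by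
  choose f hf using h
  exact ⟨(Finset.range (n + 1)).sup f, fun R hR k hk =>
    hf k R ((Finset.le_sup (Finset.mem_range.2 (Nat.lt_succ_of_le hk))).trans hR)⟩

/-- The composition property of the relations `Close`: a loss of two levels in a large ball improves
to a loss of one level in a smaller ball, how much smaller depending on a Morse gauge of `α`. -/
lemma exists_close_comp (hX : IsGeodesicSpace X) {N : MorseGauge} {α : C(ℝ≥0, X)}
    (hα : Isometry α) (hN : HasMorseGauge N (range α)) (n : ℕ) :
    ∃ m : ℕ, ∀ β γ : C(ℝ≥0, X), Isometry γ → α 0 = β 0 → α 0 = γ 0 →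
      Close m α β → Close m β γ → Close n α γ := by
  have key : ∀ k : ℕ, ∃ R₀ : ℝ≥0, ∀ R ≥ R₀, ∀ γ : C(ℝ≥0, X), Isometry γ → α 0 = γ 0 →
      (∀ j ≤ k, ∀ q, dist (α 0) q ≤ R → Reach j γ q → Reach (j + 2) α q) →
      ∀ p, dist (α 0) p ≤ n →
        (Reach k α p → Reach (k + 1) γ p) ∧ (Reach k γ p → Reach (k + 1) α p) := by
    intro k
    set D₁ : ℝ := 2 * (N (4 ^ k) k + 1) + (4 ^ k + k)
    set D₂ : ℝ := 2 * (N (4 ^ (k + 2)) (k + 2 : ℕ) + 1) + (4 ^ k + k)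
    set D₃ : ℝ := 2 * (N (4 ^ (0 + 2)) (0 + 2 : ℕ) + 1) + 0
    obtain ⟨R₁, hR₁⟩ := exists_radius_transfer hX k n (D₁ + D₃)
    obtain ⟨R₂, hR₂⟩ := exists_radius_transfer hX k n D₂
    refine ⟨max R₁ R₂, fun R hR γ hγ h0 hr p hp => ⟨?_, ?_⟩⟩
    · refine hR₁ R ((le_max_left _ _).trans hR) α γ hγ h0 (fun q hq hq₁ hq₂ => ?_) p hp
      have e₁ : dist q (α R) ≤ D₁ := dist_le_of_hasMorseGauge hα hN hq hq₁ hq₂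
      have hγR : dist (α 0) (γ R) = R := by rw [h0, dist_zero_apply hγ]
      have e₂ : dist (γ R) (α R) ≤ D₃ := dist_le_of_hasMorseGauge hα hN
        (hr 0 (Nat.zero_le k) _ hγR.le (reach_zero hγ R)) (by rw [hγR, sub_zero]) hγR.le
      exact (dist_triangle_right _ _ (α R)).trans (add_le_add e₁ e₂)
    · refine hR₂ R ((le_max_right _ _).trans hR) γ α hα h0.symm (fun q hq hq₁ hq₂ => ?_) p
        (h0 ▸ hp)
      rw [← h0] at hq₁ hq₂
      exact dist_le_of_hasMorseGauge hα hN (hr k le_rfl q hq₂ hq) hq₁ hq₂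
  obtain ⟨R₀, hR₀⟩ := exists_forall_le_of_forall key n
  obtain ⟨m, hm⟩ := exists_nat_ge R₀
  refine ⟨m + n + 1, fun β γ hγ h0 h0' hαβ hβγ p hp k hk =>
    hR₀ m hm k hk γ hγ h0' (fun j hj q hq h => ?_) p hp⟩
  have hq' : dist (α 0) q ≤ (m + n + 1 : ℕ) := by
    push_cast at hq ⊢
    linarith [n.cast_nonneg (α := ℝ)]
  exact (hαβ q hq' (j + 1) (by omega)).2 ((hβγ q (h0 ▸ hq') j (by omega)).2 h)

/-- Let `α` and `β` be uniformly close to `α₀` and `β₀`. If `α` and `β` are close at a single large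
radius, then `α₀` and `β₀` are close at level `n`. As the radius depends on `β` only through its
Morse gauge, this gives neighbourhoods in the space of rays with that gauge. -/
lemma exists_radius_close (hX : IsGeodesicSpace X) {N M : MorseGauge} {α₀ α : C(ℝ≥0, X)}
    (hα₀ : Isometry α₀) (hN : HasMorseGauge N (range α₀)) {C : ℝ≥0}
    (hα : ∀ t, dist (α₀ t) (α t) ≤ C) (n : ℕ) :
    ∃ R : ℝ≥0, ∀ β₀ β : C(ℝ≥0, X), Isometry β₀ → Isometry β → β₀ 0 = α₀ 0 → β 0 = α₀ 0 →
      HasMorseGauge M (range β) → (∀ t, dist (β₀ t) (β t) ≤ C) → dist (α R) (β R) ≤ 1 →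
      Close n α₀ β₀ := by
  have key : ∀ k : ℕ, ∃ R₀ : ℝ≥0, ∀ R ≥ R₀, ∀ β₀ β : C(ℝ≥0, X), Isometry β₀ → Isometry β →
      β₀ 0 = α₀ 0 → β 0 = α₀ 0 → HasMorseGauge M (range β) → (∀ t, dist (β₀ t) (β t) ≤ C) →
      dist (α R) (β R) ≤ 1 → ∀ p, dist (α₀ 0) p ≤ n →
        (Reach k α₀ p → Reach (k + 1) β₀ p) ∧ (Reach k β₀ p → Reach (k + 1) α₀ p) := by
    intro k
    set D₁ : ℝ := 2 * (N (4 ^ k) k + 1) + (4 ^ k + k)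
    set D₂ : ℝ := 2 * (M (4 ^ (k + 1)) (k + 1 : ℕ) + 1) + (4 ^ k + k)
    obtain ⟨R₁, hR₁⟩ := exists_radius_transfer hX k n (D₁ + (C + 1 + C))
    obtain ⟨R₂, hR₂⟩ := exists_radius_transfer hX k n (D₂ + (1 + C))
    refine ⟨max R₁ R₂, fun R hR β₀ β hβ₀ hβ h0 h0' hM hββ hαβ p hp => ⟨?_, ?_⟩⟩
    · refine hR₁ R ((le_max_left _ _).trans hR) α₀ β₀ hβ₀ h0.symm (fun q hq hq₁ hq₂ => ?_) p hp
      have e₁ : dist q (α₀ R) ≤ D₁ := dist_le_of_hasMorseGauge hα₀ hN hq hq₁ hq₂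
      have e₂ := dist_triangle4 (α₀ R) (α R) (β R) (β₀ R)
      have e₃ := dist_triangle q (α₀ R) (β₀ R)
      rw [dist_comm (β R)] at e₂
      linarith [hα R, hββ R]
    · refine hR₂ R ((le_max_right _ _).trans hR) β₀ α₀ hα₀ h0 (fun q hq hq₁ hq₂ => ?_) p
        (h0.symm ▸ hp)
      rw [h0, ← h0'] at hq₁ hq₂
      have e₁ : dist q (β R) ≤ D₂ := dist_le_of_hasMorseGauge hβ hM
        (hq.of_close hX hβ₀ hβ (h0.trans h0'.symm) fun t => ⟨t, hββ t⟩) hq₁ hq₂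
      have e₂ := dist_triangle4 q (β R) (α R) (α₀ R)
      rw [dist_comm (β R) (α R), dist_comm (α R) (α₀ R)] at e₂
      linarith [hα R]
  obtain ⟨R₀, hR₀⟩ := exists_forall_le_of_forall key n
  exact ⟨R₀, fun β₀ β h₁ h₂ h₃ h₄ h₅ h₆ h₇ p hp k hk =>
    hR₀ R₀ le_rfl k hk β₀ β h₁ h₂ h₃ h₄ h₅ h₆ h₇ p hp⟩

/-- A ray that is close at all levels to a Morse ray with the same origin stays close to it. -/
lemma dist_le_of_forall_close {N : MorseGauge} {α β : C(ℝ≥0, X)} (hα : Isometry α)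
    (hβ : Isometry β) (h0 : α 0 = β 0) (hN : HasMorseGauge N (range α))
    (h : ∀ n, Close n α β) (t : ℝ≥0) : dist (β t) (α t) ≤ fellowBound N := by
  obtain ⟨n, hn⟩ := exists_nat_ge t
  have ht : dist (α 0) (β t) = t := by rw [h0, dist_zero_apply hβ]
  have := dist_le_of_hasMorseGauge (R := t) (L := 0) hα hN
    ((h n (β t) (ht.le.trans (by exact_mod_cast hn)) 0 (Nat.zero_le n)).2 (reach_zero hβ t))
    (by rw [ht, sub_zero]) ht.le
  simpa [fellowBound] using this

/-! ### Stability of the Morse property and compactness of spaces of rays -/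

lemma IsNMorse.hasMorseGauge {N : MorseGauge} {α : C(ℝ≥0, X)} (h : IsNMorse N α) :
    HasMorseGauge N (range α) := by
  simpa using h univ ordConnected_univ

/-- A Morse gauge for geodesics that stay `C`-close to geodesics with Morse gauge `N`. -/
def MorseGauge.widen (N : MorseGauge) (C : ℝ≥0) : MorseGauge := fun K ε => N K (ε + 2 * C) + C

/-- If every initial segment of `α` is `C`-close to an `N`-Morse ray, then `α` is Morse, with a
gauge that depends only on `N` and `C`. -/
lemma isNMorse_widen {N : MorseGauge} {C : ℝ≥0} {α : C(ℝ≥0, X)}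
    (h : ∀ T : ℝ≥0, ∃ β : C(ℝ≥0, X), IsNMorse N β ∧ ∀ u ≤ T, dist (α u) (β u) ≤ C) :
    IsNMorse (N.widen C) α := by
  rintro I hI K ε σ a b hK hab hσ ⟨s, hs, hsa⟩ ⟨t, ht, htb⟩ _ ⟨c, hc, rfl⟩
  by_cases hca : c = a
  · exact self_subset_cthickening _ ⟨s, hs, by rw [hca, hsa]⟩
  by_cases hcb : c = b
  · exact self_subset_cthickening _ ⟨t, ht, by rw [hcb, htb]⟩
  obtain ⟨β, hβ, hαβ⟩ := h (max s t)
  have hJ : uIcc s t ⊆ I := hI.uIcc_subset hs ht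
  have hab' : a ≠ b := fun hab => hca (le_antisymm (hab ▸ hc.2) hc.1)
  -- moving the endpoints of `σ` onto `β` changes distances by at most `2 * C`
  let τ : ℝ → X := fun x => if x = a then β s else if x = b then β t else σ x
  have hτ : ∀ x, dist (σ x) (τ x) ≤ C := fun x => by
    by_cases hxa : x = a
    · simpa [τ, hxa, ← hsa] using hαβ s (le_max_left _ _)
    by_cases hxb : x = b
    · simpa [τ, hxb, hab'.symm, ← htb] using hαβ t (le_max_right _ _)
    · simp [τ, hxa, hxb]
  have hτqg : IsQuasiGeodesicOn K (ε + 2 * C) τ a b := fun x hx y hy => by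
    have e₁ := hσ x hx y hy
    have e₂ := dist_triangle4 (σ x) (τ x) (τ y) (σ y)
    have e₃ := dist_triangle4 (τ x) (σ x) (σ y) (τ y)
    rw [dist_comm (τ y)] at e₂
    rw [dist_comm (τ x) (σ x)] at e₃
    push_cast
    constructor <;> linarith [e₁.1, e₁.2, hτ x, hτ y]
  have hmem := hβ (uIcc s t) ordConnected_uIcc K (ε + 2 * C) τ a b hK hab hτqg
    ⟨s, left_mem_uIcc, by simp [τ]⟩ ⟨t, right_mem_uIcc, by simp [τ, hab'.symm]⟩
    (mem_image_of_mem τ hc)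
  have hsub : β '' uIcc s t ⊆ cthickening C (α '' I) := by
    rintro _ ⟨u, hu, rfl⟩
    refine mem_cthickening_of_dist_le (β u) (α u) C _ ⟨u, hJ hu, rfl⟩ ?_
    rw [dist_comm]
    exact hαβ u hu.2
  have hc' : τ c = σ c := by simp [τ, hca, hcb]
  rw [hc'] at hmem
  exact cthickening_cthickening_subset (NNReal.coe_nonneg _) C.coe_nonneg _
    (cthickening_subset_of_subset _ hsub hmem)

/-- The geodesic rays from `e` form a compact space. -/
lemma isCompact_setOf_isometry [ProperSpace X] (e : X) :
    IsCompact {α : C(ℝ≥0, X) | Isometry α ∧ α 0 = e} := by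
  refine ArzelaAscoli.isCompact_of_equicontinuous _ ?_ ?_
  · have hcpt : IsCompact (pi univ fun t : ℝ≥0 => closedBall e (t : ℝ)) :=
      isCompact_univ_pi fun t => isCompact_closedBall e t
    have hcl : IsClosed {f : ℝ≥0 → X | (∀ s t, dist (f s) (f t) = dist s t) ∧ f 0 = e} := by
      refine IsClosed.inter (s₁ := {f : ℝ≥0 → X | ∀ s t, dist (f s) (f t) = dist s t})
        (s₂ := {f : ℝ≥0 → X | f 0 = e}) ?_ (isClosed_eq (continuous_apply 0) continuous_const)
      have h : {f : ℝ≥0 → X | ∀ s t, dist (f s) (f t) = dist s t} =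
          ⋂ s, ⋂ t, {f | dist (f s) (f t) = dist s t} := by
        ext f
        simp only [mem_iInter]
        rfl
      rw [h]
      exact isClosed_iInter fun s => isClosed_iInter fun t =>
        isClosed_eq ((continuous_apply s).dist (continuous_apply t)) continuous_const
    refine (hcpt.inter_right hcl).of_isClosed_subset ?_ ?_
    · convert hcl using 1
      ext f
      constructor
      · rintro ⟨α, ⟨hα, h0⟩, rfl⟩
        exact ⟨hα.dist_eq, h0⟩
      · rintro ⟨hf, h0⟩
        exact ⟨⟨f, (Isometry.of_dist_eq hf).continuous⟩, ⟨Isometry.of_dist_eq hf, h0⟩, rfl⟩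
    · rintro _ ⟨α, ⟨hα, h0⟩, rfl⟩
      refine ⟨fun t _ => ?_, hα.dist_eq, h0⟩
      rw [mem_closedBall, dist_comm, ← h0]
      exact (dist_zero_apply hα t).le
  · exact (LipschitzWith.uniformEquicontinuous _ 1 fun α => α.2.1.lipschitz).equicontinuous

/-- The `N`-Morse rays from `e`, as a subset of `C(ℝ≥0, X)`. -/
def basedRays (e : X) (N : MorseGauge) : Set C(ℝ≥0, X) :=
  {α | Isometry α ∧ IsNMorse N α ∧ α 0 = e}

/-- A limit of `N`-Morse rays need not be `N`-Morse, as `N` may be discontinuous; it is Morse for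
a slightly larger gauge. -/
lemma closure_basedRays_subset [ProperSpace X] (e : X) (N : MorseGauge) :
    closure (basedRays e N) ⊆ basedRays e (N.widen 1) := by
  intro α hα
  have hα' : Isometry α ∧ α 0 = e := closure_minimal (s := basedRays e N)
    (t := {α | Isometry α ∧ α 0 = e}) (fun β hβ => ⟨hβ.1, hβ.2.2⟩)
    (isCompact_setOf_isometry e).isClosed hα
  refine ⟨hα'.1, isNMorse_widen fun T => ?_, hα'.2⟩
  have hunif := ContinuousMap.tendsto_iff_forall_isCompact_tendstoUniformlyOn.1
    (Filter.tendsto_id (x := 𝓝 α)) (Icc 0 T) isCompact_Icc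
  obtain ⟨β, hβ, hβN⟩ := mem_closure_iff_nhds.1 hα _
    (Metric.tendstoUniformlyOn_iff.1 hunif 1 one_pos)
  exact ⟨β, hβN.2.1, fun u hu => (hβ u ⟨zero_le, hu⟩).le⟩

lemma isCompact_closure_basedRays [ProperSpace X] (e : X) (N : MorseGauge) :
    IsCompact (closure (basedRays e N)) :=
  (isCompact_setOf_isometry e).of_isClosed_subset isClosed_closure
    (closure_minimal (fun _ hβ => ⟨hβ.1, hβ.2.2⟩) (isCompact_setOf_isometry e).isClosed)

/-! ### Representing rays of boundary points -/

lemma exists_dist_le_of_hausdorffEDist_ne_top {α β : C(ℝ≥0, X)}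
    (h : hausdorffEDist (range α) (range β) ≠ ⊤) : ∃ D : ℝ, ∀ t, ∃ t', dist (α t) (β t') ≤ D := by
  obtain ⟨D, hD⟩ := ENNReal.lt_iff_exists_nnreal_btwn.1 (lt_top_iff_ne_top.2 h)
  refine ⟨D, fun t => ?_⟩
  obtain ⟨_, ⟨t', rfl⟩, ht'⟩ := exists_edist_lt_of_hausdorffEDist_lt (mem_range_self t) hD.1
  refine ⟨t', ?_⟩
  rw [edist_nndist] at ht'
  exact_mod_cast ht'.le

lemma hausdorffEDist_ne_top_of_dist_le {α β : C(ℝ≥0, X)} {C : ℝ≥0}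
    (h : ∀ t, dist (α t) (β t) ≤ C) : hausdorffEDist (range α) (range β) ≠ ⊤ := by
  have h' : ∀ t, edist (α t) (β t) ≤ C := fun t => by
    rw [edist_nndist]
    exact_mod_cast h t
  refine ne_top_of_le_ne_top (ENNReal.coe_ne_top (r := C)) (hausdorffEDist_le_of_mem_edist ?_ ?_)
  · rintro _ ⟨t, rfl⟩
    exact ⟨β t, mem_range_self t, h' t⟩
  · rintro _ ⟨t, rfl⟩
    exact ⟨α t, mem_range_self t, edist_comm (α t) _ ▸ h' t⟩

namespace MorseBoundary

variable {e : X}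

/-- A chosen Morse ray from `e` in the class of a boundary point. -/
noncomputable def ray (y : MorseBoundary e) : C(ℝ≥0, X) := y.2.choose_spec.choose.1

lemma isometry_ray (y : MorseBoundary e) : Isometry y.ray := y.2.choose_spec.choose.2.1

lemma ray_zero (y : MorseBoundary e) : y.ray 0 = e := y.2.choose_spec.choose.2.2.2

lemma exists_isNMorse_ray (y : MorseBoundary e) : ∃ N, IsNMorse N y.ray :=
  ⟨_, y.2.choose_spec.choose.2.2.1⟩

lemma toClass_ray (y : MorseBoundary e) {N : MorseGauge} (hN : IsNMorse N y.ray) :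
    BasedRay.toClass (⟨y.ray, y.isometry_ray, hN, y.ray_zero⟩ : BasedRay e N) = y.1 :=
  y.2.choose_spec.choose_spec

lemma dist_ray_le (hX : IsGeodesicSpace X) (y : MorseBoundary e) {M : MorseGauge}
    (β : BasedRay e M) (h : β.toClass = y.1) (t : ℝ≥0) :
    dist (y.ray t) (β.1 t) ≤ fellowBound M := by
  obtain ⟨N, hN⟩ := y.exists_isNMorse_ray
  have hrel : hausdorffEDist (range y.ray) (range β.1) ≠ ⊤ :=
    Quotient.exact ((y.toClass_ray hN).trans h.symm)
  obtain ⟨D, hD⟩ := exists_dist_le_of_hausdorffEDist_ne_top hrel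
  exact dist_le_fellowBound hX y.isometry_ray β.2.1 (y.ray_zero.trans β.2.2.2.symm)
    β.2.2.1.hasMorseGauge hD t

lemma eq_of_dist_ray_le {y z : MorseBoundary e} {C : ℝ≥0}
    (h : ∀ t, dist (y.ray t) (z.ray t) ≤ C) : y = z := by
  obtain ⟨N, hN⟩ := y.exists_isNMorse_ray
  obtain ⟨M, hM⟩ := z.exists_isNMorse_ray
  refine Subtype.ext ?_
  rw [← y.toClass_ray hN, ← z.toClass_ray hM]
  exact Quotient.sound (hausdorffEDist_ne_top_of_dist_le h)

/-- All representing rays of points of the stratum with gauge `M` have a common gauge. -/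
lemma isNMorse_ray (hX : IsGeodesicSpace X) {M : MorseGauge} (x : Stratum e M) :
    IsNMorse (M.widen (fellowBound M)) (Stratum.incl e M x).ray := by
  obtain ⟨β, hβ⟩ := x.2
  exact isNMorse_widen fun _ => ⟨β.1, β.2.2.1, fun u _ => dist_ray_le hX _ β hβ u⟩

lemma localEntourages_close (hX : IsGeodesicSpace X) (e : X) :
    LocalEntourages fun n (y z : MorseBoundary e) => Close n y.ray z.ray where
  refl n y p _ k _ := ⟨Reach.succ, Reach.succ⟩
  symm n y z h := h.symm (y.ray_zero.trans z.ray_zero.symm)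
  anti m n y z hmn h := h.anti hmn
  comp y n := by
    obtain ⟨N, hN⟩ := y.exists_isNMorse_ray
    obtain ⟨m, hm⟩ := exists_close_comp hX y.isometry_ray hN.hasMorseGauge n
    exact ⟨m, fun z w => hm z.ray w.ray w.isometry_ray (y.ray_zero.trans z.ray_zero.symm)
      (y.ray_zero.trans w.ray_zero.symm)⟩
  sep y z h := by
    obtain ⟨N, hN⟩ := y.exists_isNMorse_ray
    refine (eq_of_dist_ray_le (dist_le_of_forall_close y.isometry_ray z.isometry_ray
      (y.ray_zero.trans z.ray_zero.symm) hN.hasMorseGauge h)).symm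

end MorseBoundary

/-! ### A coarser regular topology on the Morse boundary -/

/-- The Morse boundary with the topology of the relations `Close n`. It is coarser than the direct
limit topology, but regular and Hausdorff. -/
def CoarseBoundary (e : X) : Type _ := MorseBoundary e

instance (e : X) : TopologicalSpace (CoarseBoundary e) :=
  .mkOfNhds (LocalEntourages.nhdsFilter fun n (y z : MorseBoundary e) => Close n y.ray z.ray)

lemma t3Space_coarseBoundary (hX : IsGeodesicSpace X) (e : X) : T3Space (CoarseBoundary e) :=
  (MorseBoundary.localEntourages_close hX e).t3Space

/-- The identity, from the direct limit topology to the coarser topology. -/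
def MorseBoundary.toCoarse (e : X) (y : MorseBoundary e) : CoarseBoundary e := y

lemma MorseBoundary.injective_toCoarse (e : X) : Function.Injective (toCoarse e) :=
  fun _ _ h => h

lemma Stratum.injective_incl (e : X) (N : MorseGauge) : Function.Injective (Stratum.incl e N) :=
  fun _ _ h => Subtype.ext (congrArg (fun y : MorseBoundary e => y.1) h)

lemma Stratum.continuous_incl (e : X) (N : MorseGauge) : Continuous (Stratum.incl e N) :=
  ⟨fun _ hU => hU N⟩

lemma MorseBoundary.continuous_toCoarse (hX : IsGeodesicSpace X) (e : X) :
    Continuous (toCoarse e) := by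
  refine ⟨fun U hU M => ?_⟩
  rw [isOpen_coinduced, isOpen_iff_mem_nhds]
  intro α hα
  set y := Stratum.incl e M (Stratum.proj e M α)
  obtain ⟨n, -, hn⟩ := ((localEntourages_close hX e).hasBasis y).mem_iff.1 (hU y hα)
  obtain ⟨N, hN⟩ := y.exists_isNMorse_ray
  obtain ⟨R, hR⟩ := exists_radius_close (M := M) hX y.isometry_ray hN.hasMorseGauge
    (y.dist_ray_le hX α rfl) n
  have hev : Continuous fun β : BasedRay e M => dist (α.1 R) (β.1 R) := by fun_prop
  filter_upwards [hev.continuousAt.eventually (Iio_mem_nhds (by simp : dist (α.1 R) (α.1 R) < 1))]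
    with β hβ
  let z := Stratum.incl e M (Stratum.proj e M β)
  exact hn (hR z.ray β.1 z.isometry_ray β.2.1 (z.ray_zero.trans y.ray_zero.symm)
    (β.2.2.2.trans y.ray_zero.symm) β.2.2.1.hasMorseGauge (z.dist_ray_le hX β rfl) (le_of_lt hβ))

/-- The boundary points of limits of `N`-Morse rays form a compact totally disconnected set in the
coarse topology if the stratum that contains them is totally disconnected. -/
lemma exists_isCompact_isTotallyDisconnected [ProperSpace X] (hX : IsGeodesicSpace X) (e : X)
    (N : MorseGauge) (hN : TotallyDisconnectedSpace (Stratum e (N.widen 1))) :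
    ∃ F : Set (CoarseBoundary e), IsCompact F ∧ IsTotallyDisconnected F ∧
      ∀ y : MorseBoundary e, IsNMorse N y.ray → y.toCoarse ∈ F := by
  have := t3Space_coarseBoundary hX e
  let Q : Set (BasedRay e (N.widen 1)) := Subtype.val ⁻¹' closure (basedRays e N)
  have hQ : IsCompact Q := by
    rw [Subtype.isCompact_iff]
    convert isCompact_closure_basedRays e N using 1
    exact (Subtype.image_preimage_coe _ _).trans (inter_eq_right.2 (closure_basedRays_subset e N))
  let T : Set (Stratum e (N.widen 1)) := Stratum.proj e (N.widen 1) '' Q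
  have hT : CompactSpace T := isCompact_iff_compactSpace.1 (hQ.image continuous_coinduced_rng)
  let f : T → CoarseBoundary e := fun x => (Stratum.incl e _ x.1).toCoarse
  have hf : Continuous f := (MorseBoundary.continuous_toCoarse hX e).comp
    ((Stratum.continuous_incl e _).comp continuous_subtype_val)
  have hinj : Function.Injective f := fun x y h => Subtype.ext (Stratum.injective_incl e _ h)
  refine ⟨range f, isCompact_range hf, (hf.isClosedEmbedding hinj).isTotallyDisconnected_range.2
    inferInstance, fun y hy => ?_⟩
  have hmem : y.ray ∈ closure (basedRays e N) :=
    subset_closure ⟨y.isometry_ray, hy, y.ray_zero⟩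
  have hy' := (closure_basedRays_subset e N hmem).2.1
  exact ⟨⟨_, ⟨y.ray, y.isometry_ray, hy', y.ray_zero⟩, hmem, rfl⟩,
    Subtype.ext (y.toClass_ray hy')⟩

/-! ### Compact subsets of the Morse boundary -/

/-- `C` bounds, for the fixed constants `(K, ε)`, how far quasi-geodesics with endpoints on a
subgeodesic of `α` go away from it. -/
def MorseBoundAt (K ε C : ℝ≥0) (α : C(ℝ≥0, X)) : Prop :=
  ∀ I : Set ℝ≥0, I.OrdConnected → ∀ (σ : ℝ → X) (a b : ℝ), a ≤ b → IsQuasiGeodesicOn K ε σ a b →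
    σ a ∈ α '' I → σ b ∈ α '' I → σ '' Icc a b ⊆ cthickening (C : ℝ) (α '' I)

lemma IsNMorse.morseBoundAt {N : MorseGauge} {α : C(ℝ≥0, X)} (h : IsNMorse N α) {K ε C : ℝ≥0}
    (hK : 1 ≤ K) (hC : N K ε ≤ C) : MorseBoundAt K ε C α :=
  fun I hI σ a b hab hσ ha hb => (h I hI K ε σ a b hK hab hσ ha hb).trans
    (cthickening_mono (by exact_mod_cast hC) _)

/-- A compact subset of the Morse boundary has a common Morse gauge. Otherwise, for some
quasi-geodesic constants there are points of the set with larger and larger bounds; each stratum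
contains only finitely many of them, so they form an infinite closed discrete subset. -/
lemma exists_isNMorse_of_isCompact (hX : IsGeodesicSpace X) {e : X} {S : Set (MorseBoundary e)}
    (hS : IsCompact S) : ∃ N : MorseGauge, ∀ y ∈ S, IsNMorse N y.ray := by
  by_contra hcon
  have hK : ∃ K ε : ℝ≥0, 1 ≤ K ∧ ∀ C : ℝ≥0, ∃ y ∈ S, ¬ MorseBoundAt K ε C y.ray := by
    by_contra! h
    have h' : ∀ K ε : ℝ≥0, ∃ C : ℝ≥0, 1 ≤ K → ∀ y ∈ S, MorseBoundAt K ε C y.ray := fun K ε => by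
      by_cases hK : 1 ≤ K
      · obtain ⟨C, hC⟩ := h K ε hK
        exact ⟨C, fun _ => hC⟩
      · exact ⟨0, fun hK' => absurd hK' hK⟩
    choose N hN using h'
    exact hcon ⟨N, fun y hy I hI K ε σ a b hK => hN K ε hK y hy I hI σ a b⟩
  obtain ⟨K, ε, hK, hbad⟩ := hK
  choose x hxS hx using fun n : ℕ => hbad n
  have hfin : ∀ M, {n | x n ∈ range (Stratum.incl e M)}.Finite := fun M => by
    obtain ⟨m, hm⟩ := exists_nat_ge (M.widen (fellowBound M) K ε)
    refine (finite_lt_nat m).subset ?_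
    rintro n ⟨w, hw⟩
    by_contra hnm
    refine hx n ?_
    rw [← hw]
    exact (MorseBoundary.isNMorse_ray hX w).morseBoundAt hK
      (hm.trans (by exact_mod_cast not_lt.1 hnm))
  have := t3Space_coarseBoundary hX e
  have hclosed : ∀ A ⊆ range x, IsClosed A := fun A hA => by
    refine ⟨fun M => ?_⟩
    have : T1Space (Stratum e M) := t1Space_of_injective_of_continuous
      ((MorseBoundary.injective_toCoarse e).comp (Stratum.injective_incl e M))
      ((MorseBoundary.continuous_toCoarse hX e).comp (Stratum.continuous_incl e M))
    rw [preimage_compl, isOpen_compl_iff]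
    refine (Finite.of_finite_image (((hfin M).image x).subset ?_)
      (Stratum.injective_incl e M).injOn).isClosed
    rintro _ ⟨w, hw, rfl⟩
    obtain ⟨n, hn⟩ := hA hw
    exact ⟨n, ⟨w, hn.symm⟩, hn⟩
  have hrange : (range x).Finite := by
    refine (hS.of_isClosed_subset (hclosed _ subset_rfl) (range_subset_iff.2 hxS)).finite ?_
    exact isDiscrete_iff_forall_mem_exists_isClosed.2 fun A hA =>
      ⟨A, hclosed A hA, inter_eq_left.2 hA⟩
  refine infinite_univ (α := ℕ) (Finite.subset (hrange.preimage' (f := x) fun y _ => ?_)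
    fun n _ => mem_range_self n)
  obtain ⟨M, β, hβ⟩ := y.2
  exact (hfin M).subset fun n hn => ⟨⟨y.1, β, hβ⟩, hn.symm⟩

end MorseBdry

theorem proposition4p5 {X : Type*} [MetricSpace X] [ProperSpace X]
    (hX : MorseBdry.IsGeodesicSpace X) (e : X)
    (hσ : SigmaCompactSpace (MorseBdry.MorseBoundary e)) :
    TotallyDisconnectedSpace (MorseBdry.MorseBoundary e) ↔
      ∀ N : MorseBdry.MorseGauge, TotallyDisconnectedSpace (MorseBdry.Stratum e N) := by
  open MorseBdry in
  constructor
  · intro h N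
    exact ⟨isTotallyDisconnected_of_image (Stratum.continuous_incl e N).continuousOn
      (Stratum.injective_incl e N) (isTotallyDisconnected_of_totallyDisconnectedSpace _)⟩
  · intro h
    have := t3Space_coarseBoundary hX e
    choose N hN using fun n => exists_isNMorse_of_isCompact hX
      (isCompact_compactCovering (MorseBoundary e) n)
    choose F hF hFd hmem using fun n => exists_isCompact_isTotallyDisconnected hX e (N n) (h _)
    have hcov : ⋃ n, F n = univ := eq_univ_of_forall fun y => by
      obtain ⟨n, hn⟩ := exists_mem_compactCovering (X := MorseBoundary e) y
      exact mem_iUnion.2 ⟨n, hmem n y (hN n y hn)⟩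
    have : SigmaCompactSpace (CoarseBoundary e) := ⟨⟨F, hF, hcov⟩⟩
    have := totallyDisconnectedSpace_of_iUnion_isCompact F hF hFd hcov
    exact ⟨isTotallyDisconnected_of_image (MorseBoundary.continuous_toCoarse hX e).continuousOn
      (MorseBoundary.injective_toCoarse e) (isTotallyDisconnected_of_totallyDisconnectedSpace _)⟩
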